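/- Let $G$ be a locally compact Polish group (a topological group whose topology is locally compact, separable and completely metrizable), let $\mathbb K$ be $\mathbb R$ or $\mathbb C$, and let $\mathcal H$ be an infinite-dimensional separable Hilbert space over $\mathbb K$. A linear representation of $G$ on a Banach space $X$ by bounded invertible operators, or an affine representation of $G$ on $X$ by continuous affine bijections, is called continuous if the corresponding action $G\times X\to X$ is jointly continuous. A linear representation $\pi$ is bounded if $\sup_{g\in G}\|\pi(g)\|<\infty$. Then the following are equivalent. 1. $G$ is compact. 2. $G$ has property (OB): whenever $G$ acts continuously by isometries on a metric space, every orbit is bounded. 3. $G$ has property (ACR): every continuous affine action of $G$ on a separable reflexive Banach space over $\mathbb K$ has a fixed point. 4. Every continuous linear representation $\pi\colon G\to \mathrm{GL}(\mathcal H)$ is bounded. 5. Every continuous affine representation $\rho\colon G\to \mathrm{Aff}(\mathcal H)$ has a fixed point. 6. Every continuous affine representation $\rho\colon G\to \mathrm{Aff}(\mathcal H)$ has a bounded orbit. In particular, if $G$ is not compact, then $G$ admits a continuous affine representation on $\mathcal H$ all of whose orbits are unbounded. -/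

import Mathlib

universe u v w u₁ u₂ u₃ v₁ v₂

/-- Property (OB): for every continuous isometric action on a metric space, every orbit is
bounded. -/
def PropertyOB (G : Type u) [Group G] [TopologicalSpace G] : Prop :=
  ∀ (X : Type v) [MetricSpace X] [MulAction G X] [IsIsometricSMul G X] [ContinuousSMul G X]
    (x : X), Bornology.IsBounded (MulAction.orbit G x)

section Representations

variable {𝕜 : Type*} [RCLike 𝕜] {G : Type*} [Group G] [TopologicalSpace G]
  {X : Type*} [NormedAddCommGroup X] [NormedSpace 𝕜 X]

/-- A linear representation by bounded automorphisms is continuous if the corresponding action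
is jointly continuous. -/
def IsContinuousLinearRep (π : G →* (X ≃L[𝕜] X)) : Prop :=
  Continuous fun p : G × X => π p.1 p.2

/-- A linear representation is bounded if the operator norms `‖π g‖` are bounded. -/
def IsBoundedLinearRep (π : G →* (X ≃L[𝕜] X)) : Prop :=
  ∃ C : ℝ, ∀ g : G, ‖(π g : X →L[𝕜] X)‖ ≤ C

/-- A representation by affine bijections is continuous if the corresponding action is jointly
continuous; in particular every `ρ g` is then an affine homeomorphism of `X`. -/
def IsContinuousAffineRep (ρ : G →* (X ≃ᵃ[𝕜] X)) : Prop :=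
  Continuous fun p : G × X => ρ p.1 p.2

/-- The orbit of `x` under an affine representation. -/
def affineOrbit (ρ : G →* (X ≃ᵃ[𝕜] X)) (x : X) : Set X :=
  Set.range fun g : G => ρ g x

end Representations

/-- A normed space is reflexive if the canonical map into its bidual is onto. -/
def IsReflexiveSpace (𝕜 : Type*) [RCLike 𝕜] (X : Type*) [NormedAddCommGroup X]
    [NormedSpace 𝕜 X] : Prop :=
  Function.Surjective (NormedSpace.inclusionInDoubleDual 𝕜 X)

/-- Property (ACR): every continuous affine action on a separable reflexive Banach space (over
the scalar field `𝕜`) has a fixed point. -/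
def PropertyACR (𝕜 : Type w) [RCLike 𝕜] (G : Type u) [Group G] [TopologicalSpace G] : Prop :=
  ∀ (X : Type v) [NormedAddCommGroup X] [NormedSpace 𝕜 X] [CompleteSpace X]
    [TopologicalSpace.SeparableSpace X], IsReflexiveSpace 𝕜 X →
    ∀ ρ : G →* (X ≃ᵃ[𝕜] X), IsContinuousAffineRep ρ → ∃ x : X, ∀ g : G, ρ g x = x

/-! Everything for noncompact `G` comes from one weight: a Haar integrable `u : G → (0, ∞)` with `u
x * u y ≤ u (x * y)`, bounded below on compact sets (`exists_integrable_supermultiplicative`). As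
Haar measure is infinite, `u` takes arbitrarily small values.

Let `G` act by left translation on `V = L²(u⁻¹ dHaar)`. Supermultiplicativity gives `‖π g‖² ≤ 1 / u
g`. It also gives `u (g * x) * u x⁻¹ ≤ u g`, hence `‖π g f‖² ≥ (u g)⁻¹ ∫ u x⁻¹ |f x|²`, so every
nonzero vector has an unbounded orbit. The Haar integral is the inner product with `u`, which lies
in `V` because `∫ u² u⁻¹ = ∫ u < ∞`; it is therefore a continuous invariant functional. Each of its
nonzero level sets is an invariant affine hyperplane missing `0`, on which `G` acts affinely with
all orbits unbounded. Adding a trivial summand moves both actions to `H`. This refutes 4, 5 and 6.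

For (OB), `L = -log u` is subadditive and unbounded above. Averaging it against a bump function
gives `A` at bounded distance from a positive multiple of `L` whose translates vary continuously in
sup norm. The map `g ↦ g·A - A` then yields a continuous isometric action with an unbounded orbit.

For compact `G`, orbits are compact, Banach–Steinhaus bounds linear representations, and the Haar
barycenter of an orbit is a fixed point. -/

open MeasureTheory Set Filter Topology
open scoped ENNReal NNReal Pointwise

/-! ### Integrable supermultiplicative weights -/

/-- The total weight of all finite words is at most `2` if the letters have total weight at most
`1 / 2`. -/
theorem tsum_list_prod_le_two {q : ℕ → ℝ≥0∞} (hq : ∑' n, q n ≤ 2⁻¹) :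
    ∑' l : List ℕ, (l.map q).prod ≤ 2 := by
  let e : List ℕ ≃ Unit ⊕ (ℕ × List ℕ) :=
    { toFun := fun l => match l with
        | [] => .inl ()
        | n :: l => .inr (n, l)
      invFun := fun o => match o with
        | .inl _ => []
        | .inr (n, l) => n :: l
      left_inv := by rintro (_ | _) <;> rfl
      right_inv := by rintro (_ | _) <;> rfl }
  -- Splitting off the first letter gives `T = 1 + (∑ q) T`, which bounds `T` only once `T` is known
  -- to be finite; truncating by length turns it into an induction with `1 + 2⁻¹ * 2 = 2`.
  have trunc : ∀ k : ℕ, ∑' l : List ℕ, (if l.length < k then (l.map q).prod else 0) ≤ 2 := by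
    intro k
    induction k with
    | zero => simp
    | succ k ih =>
      rw [← e.symm.tsum_eq, Summable.tsum_sum ENNReal.summable ENNReal.summable]
      have h1 : ∀ a : ℕ × List ℕ,
          (if (e.symm (.inr a)).length < k + 1 then ((e.symm (.inr a)).map q).prod else 0) =
            q a.1 * (if a.2.length < k then (a.2.map q).prod else 0) := by
        rintro ⟨n, l⟩
        simp [e]
      have h0 : (if (e.symm (.inl ())).length < k + 1 then
          ((e.symm (.inl ())).map q).prod else 0) = 1 := by
        simp [e]
      simp_rw [h1]
      rw [tsum_fintype, Fintype.sum_unique, h0, ENNReal.tsum_prod']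
      simp_rw [ENNReal.tsum_mul_left, ENNReal.tsum_mul_right]
      calc 1 + (∑' n, q n) * _ ≤ 1 + 2⁻¹ * 2 := by gcongr
        _ = 2 := by
          rw [ENNReal.inv_mul_cancel (by simp) (by simp)]; norm_num
  rw [ENNReal.tsum_eq_iSup_sum]
  refine iSup_le fun s => ?_
  calc ∑ l ∈ s, (l.map q).prod
      = ∑ l ∈ s, (if l.length < s.sup List.length + 1 then (l.map q).prod else 0) := by
        refine Finset.sum_congr rfl fun l hl => ?_
        rw [if_pos (Nat.lt_succ_of_le (Finset.le_sup hl))]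
    _ ≤ _ := ENNReal.sum_le_tsum _
    _ ≤ 2 := trunc _

theorem IsCompact.list_prod {M : Type*} [Monoid M] [TopologicalSpace M] [ContinuousMul M]
    {ι : Type*} {C : ι → Set M} (hC : ∀ i, IsCompact (C i)) (l : List ι) :
    IsCompact (l.map C).prod := by
  induction l with
  | nil => simp
  | cons n l ih => simpa using (hC n).mul ih

section Weight

variable {G : Type*} [Group G] [TopologicalSpace G]

/-- If `K * C n` is covered by at most `N n` left translates of `K`, then the measure of
`K * C n₁ * ⋯ * C nₖ` is at most `N n₁ * ⋯ * N nₖ` times the measure of `K`. -/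
theorem measure_mul_list_prod_le [ContinuousMul G] [MeasurableSpace G] [BorelSpace G]
    (μ : Measure G) [μ.IsMulLeftInvariant] {K : Set G} {C : ℕ → Set G} {F : ℕ → Finset G}
    {N : ℕ → ℝ≥0∞} (hF : ∀ n, K * C n ⊆ (F n : Set G) * K) (hN : ∀ n, (F n).card ≤ N n)
    (l : List ℕ) : μ (K * (l.map C).prod) ≤ (l.map N).prod * μ K := by
  induction l with
  | nil => simp
  | cons n l ih =>
    simp only [List.map_cons, List.prod_cons]
    have : K * (C n * (l.map C).prod) ⊆ ⋃ f ∈ F n, f • (K * (l.map C).prod) := by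
      rw [← mul_assoc]
      refine (mul_subset_mul_right (hF n)).trans ?_
      rw [mul_assoc, ← iUnion_mul_left_image]
      exact subset_rfl
    calc _ ≤ _ := measure_mono this
      _ ≤ ∑ f ∈ F n, μ (f • (K * (l.map C).prod)) := measure_biUnion_finset_le _ _
      _ = (F n).card * μ (K * (l.map C).prod) := by simp [measure_smul]
      _ ≤ N n * (_ * μ K) := by gcongr; exact hN n
      _ = _ := by rw [mul_assoc]

/-- A σ-compact locally compact group carries an integrable supermultiplicative function which is
bounded away from zero on compact sets. -/
theorem exists_integrable_supermultiplicative [IsTopologicalGroup G]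
    [LocallyCompactSpace G] [SigmaCompactSpace G]
    [T2Space G] [MeasurableSpace G] [BorelSpace G] (μ : Measure G) [μ.IsMulLeftInvariant]
    [IsFiniteMeasureOnCompacts μ] :
    ∃ u : G → ℝ≥0, Measurable u ∧ (∀ x, 0 < u x) ∧ (∀ x y, u x * u y ≤ u (x * y)) ∧
      ∫⁻ x, u x ∂μ ≠ ∞ ∧ ∀ C : Set G, IsCompact C → ∃ c > 0, ∀ x ∈ C, c ≤ u x := by
  obtain ⟨K, hK, hK1⟩ := exists_compact_mem_nhds (1 : G)
  let C : CompactExhaustion G := default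
  have hcov : ∀ n, ∃ F : Finset G, K * C n ⊆ (F : Set G) * K := by
    intro n
    classical
    obtain ⟨t, ht⟩ := compact_covered_by_mul_left_translates (hK.mul (C.isCompact n))
      (V := K) ⟨1, mem_interior_iff_mem_nhds.2 hK1⟩
    refine ⟨t.image (·⁻¹), fun x hx => ?_⟩
    obtain ⟨g, hg, hgx⟩ := mem_iUnion₂.1 (ht hx)
    exact mem_mul.2 ⟨g⁻¹, by simpa using hg, g * x, hgx, by simp⟩
  choose F hF using hcov
  -- The `+ 1` makes `N n` invertible with inverse at most `1`.
  let N : ℕ → ℝ≥0∞ := fun n => ((F n).card + 1 : ℕ)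
  have hN0 : ∀ n, N n ≠ 0 := fun n => by simp [N]
  have hNt : ∀ n, N n ≠ ∞ := fun n => by simp [N]
  have hN1 : ∀ n, (N n)⁻¹ ≤ 1 := fun n => by
    rw [ENNReal.inv_le_one]; simp [N]
  -- `(N n)⁻¹` cancels the growth of measure caused by multiplying by `C n`; the remaining factors
  -- `2⁻¹ ^ (n + 2)` sum to `1 / 2`.
  let p : ℕ → ℝ≥0∞ := fun n => 2⁻¹ ^ (n + 2) * (N n)⁻¹
  have hp0 : ∀ n, p n ≠ 0 := fun n => mul_ne_zero (by simp) (by simp [hNt])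
  have hp1 : ∀ n, p n ≤ 1 := fun n =>
    mul_le_one' (pow_le_one' (by simp) _) (hN1 n)
  let w : List ℕ → ℝ≥0∞ := fun l => (l.map p).prod
  have hw1 : ∀ l, w l ≤ 1 := fun l => by
    simpa using List.prod_le_pow_card (l.map p) 1 (by simpa using fun a _ => hp1 a)
  let S : List ℕ → Set G := fun l => (l.map C).prod
  have hS : ∀ l, IsCompact (S l) := IsCompact.list_prod C.isCompact
  -- The best weight of a word whose product set contains `x`. Concatenating words for `x` and `y`
  -- gives one for `x * y`, hence supermultiplicativity.
  let v : G → ℝ≥0∞ := fun x => ⨆ l, (S l).indicator (fun _ => w l) x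
  have hv : Measurable v := Measurable.iSup fun l =>
    measurable_const.indicator (hS l).measurableSet
  have hv1 : ∀ x, v x ≤ 1 := fun x => iSup_le fun l =>
    (indicator_le_self' (by simp) x).trans (hw1 l)
  have hvt : ∀ x, v x ≠ ∞ := fun x => ne_top_of_le_ne_top ENNReal.one_ne_top (hv1 x)
  have hvS : ∀ l, ∀ x ∈ S l, w l ≤ v x := fun l x hx => by
    refine le_trans ?_ (le_iSup _ l)
    simp [indicator_of_mem hx]
  have hvC : ∀ n, ∀ x ∈ C n, p n ≤ v x := fun n x hx => by
    simpa [w] using hvS [n] x (by simpa [S] using hx)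
  have hv0 : ∀ x, v x ≠ 0 := fun x => by
    obtain ⟨n, hn⟩ := C.exists_mem x
    exact ((pos_iff_ne_zero.2 (hp0 n)).trans_le (hvC n x hn)).ne'
  have hmul : ∀ x y, v x * v y ≤ v (x * y) := by
    intro x y
    simp only [v, ENNReal.iSup_mul, ENNReal.mul_iSup]
    refine iSup_le fun l' => iSup_le fun l => ?_
    by_cases hx : x ∈ S l
    swap
    · rw [indicator_of_notMem hx, zero_mul]; exact zero_le
    by_cases hy : y ∈ S l'
    swap
    · rw [indicator_of_notMem hy, mul_zero]; exact zero_le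
    rw [indicator_of_mem hx, indicator_of_mem hy]
    refine le_trans ?_ (hvS (l ++ l') (x * y) ?_)
    · simp [w]
    · simpa [S] using mul_mem_mul hx hy
  have hu_int : ∫⁻ x, v x ∂μ ≤ 2 * μ K := by
    calc ∫⁻ x, v x ∂μ ≤ ∫⁻ x, ∑' l, (S l).indicator (fun _ => w l) x ∂μ := by
          gcongr with x
          exact iSup_le fun l => ENNReal.le_tsum l
      _ = ∑' l, w l * μ (S l) := by
          rw [lintegral_tsum fun l =>
            (measurable_const.indicator (hS l).measurableSet).aemeasurable]
          congr with l
          rw [lintegral_indicator_const (hS l).measurableSet]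
      _ ≤ ∑' l : List ℕ, (l.map fun n => (2⁻¹ : ℝ≥0∞) ^ (n + 2)).prod * μ K := by
          refine ENNReal.tsum_le_tsum fun l => ?_
          have h1 : μ (S l) ≤ (l.map N).prod * μ K := by
            refine (measure_mono ?_).trans
              (measure_mul_list_prod_le μ hF (fun n => by simp [N]) l)
            exact subset_mul_right _ (mem_of_mem_nhds hK1)
          calc w l * μ (S l) ≤ w l * ((l.map N).prod * μ K) := by gcongr
            _ = (l.map fun n => p n * N n).prod * μ K := by
              rw [← mul_assoc, List.prod_map_mul]
            _ = _ := by
              congr 3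
              ext n
              simp only [p]
              rw [mul_assoc, ENNReal.inv_mul_cancel (hN0 n) (hNt n), mul_one]
      _ = (∑' l : List ℕ, (l.map fun n => (2⁻¹ : ℝ≥0∞) ^ (n + 2)).prod) * μ K := by
          rw [ENNReal.tsum_mul_right]
      _ ≤ 2 * μ K := by
          gcongr
          refine tsum_list_prod_le_two ?_
          simp_rw [pow_add, ENNReal.tsum_mul_right, ENNReal.tsum_geometric,
            ENNReal.one_sub_inv_two, inv_inv]
          rw [pow_two, ← mul_assoc, ENNReal.mul_inv_cancel (by simp) (by simp), one_mul]
  refine ⟨fun x => (v x).toNNReal, hv.ennreal_toNNReal, fun x =>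
    ENNReal.toNNReal_pos (hv0 x) (hvt x), fun x y => ?_, ?_, fun D hD => ?_⟩
  · rw [← ENNReal.toNNReal_mul]
    exact ENNReal.toNNReal_mono (hvt _) (hmul x y)
  · simp_rw [ENNReal.coe_toNNReal (hvt _)]
    exact ne_top_of_le_ne_top (ENNReal.mul_ne_top (by simp) hK.measure_lt_top.ne) hu_int
  · obtain ⟨n, hn⟩ := C.exists_superset_of_isCompact hD
    refine ⟨(p n).toNNReal, ENNReal.toNNReal_pos (hp0 n)
      (ne_top_of_le_ne_top ENNReal.one_ne_top (hp1 n)), fun x hx => ?_⟩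
    exact ENNReal.toNNReal_mono (hvt _) (hvC n x (hn hx))

end Weight

/-! ### Hilbert spaces: reflexivity and absorption of separable summands -/

section Hilbert

/-- Riesz representation twice: identifying the dual with `E` is conjugate linear, so the conjugate
of `Φ` becomes a functional on `E`, represented by a vector. -/
theorem isReflexiveSpace_of_innerProductSpace (𝕜 : Type*) [RCLike 𝕜] (E : Type*)
    [NormedAddCommGroup E] [InnerProductSpace 𝕜 E] [CompleteSpace E] : IsReflexiveSpace 𝕜 E := by
  intro Φ
  let f : StrongDual 𝕜 E := LinearMap.mkContinuous
    { toFun := fun x => star (Φ (InnerProductSpace.toDual 𝕜 E x))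
      map_add' := by simp
      map_smul' := by simp [map_smulₛₗ] } ‖Φ‖ fun x => by
        simpa using Φ.le_opNorm (InnerProductSpace.toDual 𝕜 E x)
  refine ⟨(InnerProductSpace.toDual 𝕜 E).symm f, ?_⟩
  ext φ
  obtain ⟨x, rfl⟩ := (InnerProductSpace.toDual 𝕜 E).surjective φ
  rw [NormedSpace.dual_def, InnerProductSpace.toDual_apply_apply, ← inner_conj_symm,
    InnerProductSpace.toDual_symm_apply]
  simp [f]

theorem IsReflexiveSpace.of_continuousLinearEquiv {𝕜 : Type*} [RCLike 𝕜] {E F : Type*}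
    [NormedAddCommGroup E] [NormedSpace 𝕜 E] [NormedAddCommGroup F] [NormedSpace 𝕜 F]
    (e : E ≃L[𝕜] F) (h : IsReflexiveSpace 𝕜 E) : IsReflexiveSpace 𝕜 F := by
  intro Φ
  let T : StrongDual 𝕜 E →L[𝕜] StrongDual 𝕜 F :=
    (ContinuousLinearMap.compL 𝕜 F E 𝕜).flip (e.symm : F →L[𝕜] E)
  obtain ⟨x, hx⟩ := h (Φ.comp T)
  refine ⟨e x, ?_⟩
  ext φ
  have h1 := congrArg (fun Ψ => Ψ (φ.comp (e : E →L[𝕜] F))) hx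
  have h2 : T (φ.comp (e : E →L[𝕜] F)) = φ := by ext y; simp [T]
  simpa [NormedSpace.dual_def, h2] using h1

/-- An orthonormal family in a separable space is countable. -/
theorem Orthonormal.countable {𝕜 E ι : Type*} [RCLike 𝕜] [NormedAddCommGroup E]
    [InnerProductSpace 𝕜 E] [TopologicalSpace.SeparableSpace E] {v : ι → E}
    (hv : Orthonormal 𝕜 v) : Countable ι := by
  refine Pairwise.countable_of_isOpen_disjoint (s := fun i => Metric.ball (v i) 2⁻¹) ?_
    (fun _ => Metric.isOpen_ball) fun i => Metric.nonempty_ball.2 (by norm_num)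
  intro i j hij
  refine Metric.ball_disjoint_ball ?_
  have h1 : ‖v i - v j‖ * ‖v i - v j‖ = 2 := by
    rw [norm_sub_mul_self (𝕜 := 𝕜), hv.2 hij, hv.1, hv.1]
    norm_num
  rw [dist_eq_norm]
  nlinarith [norm_nonneg (v i - v j)]

theorem exists_hilbertBasis_nat {𝕜 E : Type*} [RCLike 𝕜]
    [NormedAddCommGroup E] [InnerProductSpace 𝕜 E] [CompleteSpace E]
    [TopologicalSpace.SeparableSpace E] (hE : ¬ FiniteDimensional 𝕜 E) :
    Nonempty (HilbertBasis ℕ 𝕜 E) := by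
  obtain ⟨w, b, -⟩ := exists_hilbertBasis 𝕜 E
  have : Countable w := b.orthonormal.countable
  have : Infinite w := by
    by_contra h
    rw [not_infinite_iff_finite] at h
    have := Fintype.ofFinite w
    exact hE (Module.Finite.of_basis b.toOrthonormalBasis.toBasis)
  obtain ⟨e⟩ := nonempty_equiv_of_countable (α := ℕ) (β := w)
  refine ⟨HilbertBasis.mk (v := b ∘ e) (b.orthonormal.comp _ e.injective) ?_⟩
  rw [e.surjective.range_comp, b.dense_span]

/-- Two infinite-dimensional separable Hilbert spaces are isometrically isomorphic. -/
theorem nonempty_linearIsometryEquiv_of_separable {𝕜 E F : Type*} [RCLike 𝕜]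
    [NormedAddCommGroup E] [InnerProductSpace 𝕜 E] [CompleteSpace E]
    [TopologicalSpace.SeparableSpace E] [NormedAddCommGroup F] [InnerProductSpace 𝕜 F]
    [CompleteSpace F] [TopologicalSpace.SeparableSpace F]
    (hE : ¬ FiniteDimensional 𝕜 E) (hF : ¬ FiniteDimensional 𝕜 F) :
    Nonempty (E ≃ₗᵢ[𝕜] F) := by
  obtain ⟨b⟩ := exists_hilbertBasis_nat hE
  obtain ⟨c⟩ := exists_hilbertBasis_nat hF
  exact ⟨b.repr.trans c.repr.symm⟩

/-- An infinite-dimensional separable Hilbert space absorbs separable Hilbert spaces. -/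
theorem nonempty_prod_continuousLinearEquiv {𝕜 E F : Type*} [RCLike 𝕜]
    [NormedAddCommGroup E] [InnerProductSpace 𝕜 E] [CompleteSpace E]
    [TopologicalSpace.SeparableSpace E] [NormedAddCommGroup F] [InnerProductSpace 𝕜 F]
    [CompleteSpace F] [TopologicalSpace.SeparableSpace F] (hF : ¬ FiniteDimensional 𝕜 F) :
    Nonempty ((E × F) ≃L[𝕜] F) := by
  have e := WithLp.prodContinuousLinearEquiv 2 𝕜 E F
  have : TopologicalSpace.SeparableSpace (WithLp 2 (E × F)) :=
    e.symm.surjective.denseRange.separableSpace e.symm.continuous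
  have h : ¬ FiniteDimensional 𝕜 (WithLp 2 (E × F)) := fun h => hF <|
    Module.Finite.of_surjective ((ContinuousLinearMap.snd 𝕜 E F).toLinearMap ∘ₗ
      e.toLinearEquiv.toLinearMap) (Prod.snd_surjective.comp e.surjective)
  obtain ⟨f⟩ := nonempty_linearIsometryEquiv_of_separable h hF
  exact ⟨e.symm.trans f.toContinuousLinearEquiv⟩

end Hilbert

/-- Distances to a dense sequence determine a point. This lets (OB) and (ACR), which quantify over
one universe, be applied to spaces living in another. -/
theorem small_of_separableSpace (X : Type*) [MetricSpace X]
    [TopologicalSpace.SeparableSpace X] : Small.{v} X := by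
  rcases isEmpty_or_nonempty X with h | h
  · infer_instance
  refine small_of_injective (β := ℕ → ℝ)
    (f := fun x n => dist x (TopologicalSpace.denseSeq X n)) fun x y hxy => ?_
  have h : (fun z => dist x z) = fun z => dist y z :=
    (TopologicalSpace.denseRange_denseSeq X).equalizer (by fun_prop) (by fun_prop) hxy
  simpa using (congrFun h y)

/-! ### Linear and affine representations: conjugation, products, hyperplanes, continuity -/

section Representations

variable {𝕜 : Type*} [RCLike 𝕜] {G : Type*} [Group G] {X Y : Type*}
  [NormedAddCommGroup X] [NormedSpace 𝕜 X] [NormedAddCommGroup Y] [NormedSpace 𝕜 Y]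

@[simp]
theorem ContinuousLinearEquiv.one_apply' (x : X) : (1 : X ≃L[𝕜] X) x = x := rfl

@[simp]
theorem ContinuousLinearEquiv.mul_apply' (e f : X ≃L[𝕜] X) (x : X) : (e * f) x = e (f x) := rfl

theorem IsContinuousLinearRep.comp [TopologicalSpace G] {π : G →* (X ≃L[𝕜] X)}
    (hπ : IsContinuousLinearRep π) {Z : Type*} [TopologicalSpace Z] {a : Z → G} {b : Z → X}
    (ha : Continuous a) (hb : Continuous b) : Continuous fun z => π (a z) (b z) :=
  Continuous.comp (g := fun p : G × X => π p.1 p.2) hπ (ha.prodMk hb)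

theorem IsContinuousAffineRep.comp [TopologicalSpace G] {ρ : G →* (X ≃ᵃ[𝕜] X)}
    (hρ : IsContinuousAffineRep ρ) {Z : Type*} [TopologicalSpace Z] {a : Z → G} {b : Z → X}
    (ha : Continuous a) (hb : Continuous b) : Continuous fun z => ρ (a z) (b z) :=
  Continuous.comp (g := fun p : G × X => ρ p.1 p.2) hρ (ha.prodMk hb)

/-- The conjugate of an affine representation by a linear homeomorphism. -/
def affineRepCongr (e : X ≃L[𝕜] Y) (ρ : G →* (X ≃ᵃ[𝕜] X)) : G →* (Y ≃ᵃ[𝕜] Y) where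
  toFun g := (e.symm.toLinearEquiv.toAffineEquiv.trans (ρ g)).trans e.toLinearEquiv.toAffineEquiv
  map_one' := by ext; simp
  map_mul' g h := by ext; simp

@[simp]
theorem affineRepCongr_apply (e : X ≃L[𝕜] Y) (ρ : G →* (X ≃ᵃ[𝕜] X)) (g : G) (y : Y) :
    affineRepCongr e ρ g y = e (ρ g (e.symm y)) := rfl

theorem IsContinuousAffineRep.congr [TopologicalSpace G] {ρ : G →* (X ≃ᵃ[𝕜] X)}
    (hρ : IsContinuousAffineRep ρ)
    (e : X ≃L[𝕜] Y) : IsContinuousAffineRep (affineRepCongr e ρ) := by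
  have : Continuous fun p : G × Y => ρ p.1 (e.symm p.2) :=
    hρ.comp (by fun_prop) (by fun_prop)
  exact e.continuous.comp this

theorem isBounded_affineOrbit_of_congr {e : X ≃L[𝕜] Y} {ρ : G →* (X ≃ᵃ[𝕜] X)} {y : Y}
    (h : Bornology.IsBounded (affineOrbit (affineRepCongr e ρ) y)) :
    Bornology.IsBounded (affineOrbit ρ (e.symm y)) := by
  refine (e.symm.lipschitz.isBounded_image h).subset ?_
  rintro _ ⟨g, rfl⟩
  exact ⟨_, ⟨g, rfl⟩, by simp⟩

/-- The conjugate of a linear representation by a linear homeomorphism. -/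
def linearRepCongr (e : X ≃L[𝕜] Y) (π : G →* (X ≃L[𝕜] X)) : G →* (Y ≃L[𝕜] Y) where
  toFun g := (e.symm.trans (π g)).trans e
  map_one' := by ext; simp
  map_mul' g h := by ext; simp

theorem IsContinuousLinearRep.congr [TopologicalSpace G] {π : G →* (X ≃L[𝕜] X)}
    (hπ : IsContinuousLinearRep π)
    (e : X ≃L[𝕜] Y) : IsContinuousLinearRep (linearRepCongr e π) := by
  have : Continuous fun p : G × Y => π p.1 (e.symm p.2) :=
    hπ.comp (by fun_prop) (by fun_prop)
  exact e.continuous.comp this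

theorem IsBoundedLinearRep.exists_norm_apply_le {π : G →* (X ≃L[𝕜] X)}
    (hπ : IsBoundedLinearRep π) (x : X) : ∃ C : ℝ, ∀ g, ‖π g x‖ ≤ C := by
  obtain ⟨C, hC⟩ := hπ
  exact ⟨C * ‖x‖, fun g => (π g : X →L[𝕜] X).le_of_opNorm_le (hC g) x⟩

theorem isBoundedLinearRep_of_congr {e : X ≃L[𝕜] Y} {π : G →* (X ≃L[𝕜] X)}
    (h : IsBoundedLinearRep (linearRepCongr e π)) : ∀ x, ∃ C : ℝ, ∀ g, ‖π g x‖ ≤ C := by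
  intro x
  obtain ⟨C, hC⟩ := h.exists_norm_apply_le (e x)
  refine ⟨‖(e.symm : Y →L[𝕜] X)‖ * C, fun g => ?_⟩
  have h1 : π g x = e.symm (linearRepCongr e π g (e x)) := by simp [linearRepCongr]
  rw [h1]
  exact (e.symm : Y →L[𝕜] X).le_opNorm_of_le (hC g)

/-- The product of a linear representation with the trivial one. -/
def linearRepProd (Y : Type*) [NormedAddCommGroup Y] [NormedSpace 𝕜 Y]
    (π : G →* (X ≃L[𝕜] X)) : G →* ((X × Y) ≃L[𝕜] (X × Y)) where
  toFun g := (π g).prodCongr (.refl 𝕜 Y)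
  map_one' := by ext x <;> simp
  map_mul' g h := by ext <;> simp

theorem IsContinuousLinearRep.prod [TopologicalSpace G] {π : G →* (X ≃L[𝕜] X)}
    (hπ : IsContinuousLinearRep π) :
    IsContinuousLinearRep (linearRepProd Y π) := by
  have : Continuous fun p : G × (X × Y) => π p.1 p.2.1 :=
    hπ.comp (by fun_prop) (by fun_prop)
  exact this.prodMk (continuous_snd.comp continuous_snd)

/-- The product of an affine representation with the trivial one. -/
def affineRepProd (Y : Type*) [NormedAddCommGroup Y] [NormedSpace 𝕜 Y]
    (ρ : G →* (X ≃ᵃ[𝕜] X)) : G →* ((X × Y) ≃ᵃ[𝕜] (X × Y)) where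
  toFun g := (ρ g).prodCongr (.refl 𝕜 Y)
  map_one' := by ext x <;> simp
  map_mul' g h := by ext <;> simp

theorem IsContinuousAffineRep.prod [TopologicalSpace G] {ρ : G →* (X ≃ᵃ[𝕜] X)}
    (hρ : IsContinuousAffineRep ρ) :
    IsContinuousAffineRep (affineRepProd Y ρ) := by
  have : Continuous fun p : G × (X × Y) => ρ p.1 p.2.1 :=
    hρ.comp (by fun_prop) (by fun_prop)
  exact this.prodMk (continuous_snd.comp continuous_snd)

theorem isBounded_affineOrbit_of_prod {ρ : G →* (X ≃ᵃ[𝕜] X)} {p : X × Y}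
    (h : Bornology.IsBounded (affineOrbit (affineRepProd Y ρ) p)) :
    Bornology.IsBounded (affineOrbit ρ p.1) := by
  refine h.image_fst.subset ?_
  rintro _ ⟨g, rfl⟩
  exact ⟨_, ⟨g, rfl⟩, rfl⟩

/-- If a linear representation fixes the functional `φ`, it acts by affine maps on the hyperplane
`φ = φ v`, identified with `ker φ` by subtracting `v`. -/
def affineRepKer (π : G →* (X ≃L[𝕜] X)) (φ : StrongDual 𝕜 X) (hφ : ∀ g x, φ (π g x) = φ x)
    (v : X) : G →* (φ.ker ≃ᵃ[𝕜] φ.ker) :=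
  -- A monoid homomorphism out of a group lands in the units, so only affine maps, not their
  -- inverses, need be constructed.
  AffineEquiv.equivUnitsAffineMap.symm.toMonoidHom.comp <| MonoidHom.toHomUnits
    { toFun := fun g =>
        { toFun := fun x => ⟨π g (x + v) - v, by simp [hφ]⟩
          linear := ((π g).toLinearEquiv.toLinearMap.domRestrict φ.ker).codRestrict φ.ker
            fun x => by simp [hφ]
          map_vadd' := fun x y => by
            ext
            change π g (y + x + v) - v = π g y + (π g (x + v) - v)
            rw [add_assoc, map_add, add_sub_assoc] }
      map_one' := by ext; simp
      map_mul' := fun g h => by ext; simp }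

theorem isContinuousAffineRep_affineRepKer [TopologicalSpace G] {π : G →* (X ≃L[𝕜] X)}
    (hπ : IsContinuousLinearRep π)
    (φ : StrongDual 𝕜 X) (hφ : ∀ g x, φ (π g x) = φ x) (v : X) :
    IsContinuousAffineRep (affineRepKer π φ hφ v) := by
  refine Continuous.subtype_mk (Continuous.sub ?_ continuous_const) _
  exact hπ.comp (by fun_prop) (by fun_prop)

/-- A linear representation is jointly continuous if its norms are locally bounded and the orbit
maps of a dense set of vectors are continuous. -/
theorem isContinuousLinearRep_of_dense [TopologicalSpace G] [WeaklyLocallyCompactSpace G]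
    {π : G →* (X ≃L[𝕜] X)}
    (hb : ∀ C : Set G, IsCompact C → ∃ c : ℝ, ∀ g ∈ C, ∀ x, ‖π g x‖ ≤ c * ‖x‖)
    {D : Set X} (hD : Dense D) (hc : ∀ x ∈ D, Continuous fun g => π g x) :
    IsContinuousLinearRep π := by
  refine continuous_iff_continuousAt.2 fun ⟨g₀, x₀⟩ => Metric.tendsto_nhds.2 fun ε hε => ?_
  obtain ⟨C, hC, hg₀⟩ := exists_compact_mem_nhds g₀
  obtain ⟨c, hc'⟩ := hb C hC
  set c' := |c| + 1
  have hc0 : 0 < c' := by positivity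
  have hcb : ∀ g ∈ C, ∀ x, ‖π g x‖ ≤ c' * ‖x‖ := fun g hg x =>
    (hc' g hg x).trans (by gcongr; exact (le_abs_self c).trans (by simp [c']))
  obtain ⟨y, hy, hyD⟩ := Metric.dense_iff.1 hD x₀ (ε / 4 / c') (by positivity)
  have h1 : ∀ᶠ g in 𝓝 g₀, dist (π g y) (π g₀ y) < ε / 4 :=
    Metric.tendsto_nhds.1 (hc y hyD).continuousAt _ (by positivity)
  have h2 : ∀ᶠ x in 𝓝 x₀, dist x y < ε / 4 / c' := by
    refine (Metric.isOpen_ball.mem_nhds ?_)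
    rw [Metric.mem_ball]
    rwa [Metric.mem_ball'] at hy
  rw [nhds_prod_eq]
  have h3 : ∀ᶠ g in 𝓝 g₀, g ∈ C := hg₀
  filter_upwards [(h1.and h3).prod_mk h2] with ⟨g, x⟩ ⟨⟨hg1, hgC⟩, hx⟩
  have e1 : dist (π g x) (π g y) < ε / 4 := by
    rw [dist_eq_norm, ← map_sub]
    refine (hcb g hgC _).trans_lt ?_
    rw [dist_eq_norm, lt_div_iff₀ hc0] at hx
    linarith
  have e2 : dist (π g₀ y) (π g₀ x₀) < ε / 4 := by
    rw [dist_eq_norm, ← map_sub]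
    refine (hcb g₀ (mem_of_mem_nhds hg₀) _).trans_lt ?_
    rw [Metric.mem_ball, dist_eq_norm, lt_div_iff₀ hc0] at hy
    linarith
  have := dist_triangle4 (π g x) (π g y) (π g₀ y) (π g₀ x₀)
  dsimp only
  linarith

/-! ### Compact groups -/

variable [TopologicalSpace G] [CompactSpace G]

/-- Orbits are compact, hence bounded, and the uniform boundedness principle applies. -/
theorem isBoundedLinearRep_of_compactSpace [CompleteSpace X] {π : G →* (X ≃L[𝕜] X)}
    (hπ : IsContinuousLinearRep π) : IsBoundedLinearRep π := by
  refine banach_steinhaus fun x => ?_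
  have : Continuous fun g => π g x :=
    hπ.comp (by fun_prop) (by fun_prop)
  obtain ⟨C, hC⟩ := isCompact_univ.exists_bound_of_continuousOn this.continuousOn
  exact ⟨C, fun g => hC g trivial⟩

/-- A continuous affine action of a compact group on a Banach space fixes the barycenter of each
of its orbits. -/
theorem exists_fixedPoint_of_compactSpace [IsTopologicalGroup G]
    [SecondCountableTopology G] [CompleteSpace X]
    {ρ : G →* (X ≃ᵃ[𝕜] X)} (hρ : IsContinuousAffineRep ρ) : ∃ x, ∀ g, ρ g x = x := by
  borelize G
  let _ : NormedSpace ℝ X := NormedSpace.restrictScalars ℝ 𝕜 X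
  let μ : Measure G := Measure.haarMeasure ⊤
  have : IsProbabilityMeasure μ := ⟨Measure.haarMeasure_self⟩
  have hc : Continuous fun g => ρ g 0 :=
    hρ.comp (by fun_prop) (by fun_prop)
  have hi : Integrable (fun g => ρ g 0) μ :=
    hc.integrable_of_hasCompactSupport (HasCompactSupport.of_compactSpace _)
  refine ⟨∫ g, ρ g 0 ∂μ, fun h => ?_⟩
  have hch : Continuous (ρ h) :=
    hρ.comp (by fun_prop) (by fun_prop)
  -- An affine map commutes with averages over a probability measure: its linear part passes under
  -- the integral and the constant averages to itself.
  let T : X →L[𝕜] X := ⟨(ρ h).linear.toLinearMap,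
    (AffineMap.continuous_linear_iff (f := (ρ h).toAffineMap)).2 hch⟩
  have hT : ∀ x, ρ h x = T x + ρ h 0 := fun x => by
    have := (ρ h).map_vadd 0 x
    rwa [vadd_eq_add, vadd_eq_add, add_zero] at this
  calc ρ h (∫ g, ρ g 0 ∂μ) = T (∫ g, ρ g 0 ∂μ) + ρ h 0 := hT _
    _ = ∫ g, (T (ρ g 0) + ρ h 0) ∂μ := by
      rw [← T.integral_comp_comm hi, integral_add (T.integrable_comp hi) (integrable_const _)]
      simp
    _ = ∫ g, ρ (h * g) 0 ∂μ := by simp [← hT]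
    _ = ∫ g, ρ g 0 ∂μ := integral_mul_left_eq_self (fun g => ρ g 0) h

end Representations

/-! ### Translation on `L²` of a quasi-invariant measure -/

section Translation

variable {𝕜 : Type*} [RCLike 𝕜] {G : Type*} [Group G] [TopologicalSpace G]
  [IsTopologicalGroup G] [MeasurableSpace G] [BorelSpace G] {μ : Measure G} {c : G → ℝ≥0}

theorem quasiMeasurePreserving_mul_left_of_map_le (hc : ∀ g, μ.map (g * ·) ≤ (c g : ℝ≥0∞) • μ)
    (g : G) : Measure.QuasiMeasurePreserving (g * ·) μ μ :=
  ⟨(Homeomorph.mulLeft g).measurable, Measure.absolutelyContinuous_of_le_smul (hc g)⟩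

theorem eLpNorm_comp_mul_left_le (hc : ∀ g, μ.map (g * ·) ≤ (c g : ℝ≥0∞) • μ) (g : G)
    {f : G → 𝕜} (hf : AEStronglyMeasurable f μ) :
    eLpNorm (fun x => f (g * x)) 2 μ ≤ ((c g) ^ (1 / 2 : ℝ) : ℝ≥0) * eLpNorm f 2 μ := by
  have hq := quasiMeasurePreserving_mul_left_of_map_le hc g
  rw [← Function.comp_def f, ← eLpNorm_map_measure (hf.mono_ac hq.absolutelyContinuous)
    hq.measurable.aemeasurable]
  refine (eLpNorm_le_of_measure_le_smul (hc g)).trans_eq ?_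
  rw [smul_eq_mul, ENNReal.coe_rpow_of_nonneg _ (by norm_num)]
  norm_num

theorem MeasureTheory.MemLp.comp_mul_left (hc : ∀ g, μ.map (g * ·) ≤ (c g : ℝ≥0∞) • μ) (g : G)
    {f : G → 𝕜} (hf : MemLp f 2 μ) : MemLp (fun x => f (g * x)) 2 μ :=
  ⟨hf.1.comp_quasiMeasurePreserving (quasiMeasurePreserving_mul_left_of_map_le hc g),
    (eLpNorm_comp_mul_left_le hc g hf.1).trans_lt (ENNReal.mul_lt_top (by simp) hf.2)⟩

theorem norm_toLp_comp_mul_left_le (hc : ∀ g, μ.map (g * ·) ≤ (c g : ℝ≥0∞) • μ) (g : G)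
    (f : Lp 𝕜 2 μ) : ‖((Lp.memLp f).comp_mul_left hc g).toLp _‖ ≤
      ((c g) ^ (1 / 2 : ℝ) : ℝ≥0) * ‖f‖ := by
  rw [Lp.norm_toLp, Lp.norm_def, ← ENNReal.coe_toReal, ← ENNReal.toReal_mul]
  exact ENNReal.toReal_mono (ENNReal.mul_ne_top (by simp) (Lp.eLpNorm_ne_top f))
    (eLpNorm_comp_mul_left_le hc g (Lp.aestronglyMeasurable f))

variable (𝕜) in
/-- The representation of `G` by left translation on the space `L²(G, μ)` of a measure whose left
translates are dominated by multiples of `μ`. -/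
noncomputable def translationRep (hc : ∀ g, μ.map (g * ·) ≤ (c g : ℝ≥0∞) • μ) :
    G →* (Lp 𝕜 2 μ ≃L[𝕜] Lp 𝕜 2 μ) :=
  (ContinuousLinearEquiv.unitsEquiv 𝕜 (Lp 𝕜 2 μ)).toMonoidHom.comp <| MonoidHom.toHomUnits
    { toFun := fun g => LinearMap.mkContinuous
        { toFun := fun f => ((Lp.memLp f).comp_mul_left hc g⁻¹).toLp _
          map_add' := fun f f' => by
            ext1
            filter_upwards [MemLp.coeFn_toLp ((Lp.memLp (f + f')).comp_mul_left hc g⁻¹),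
              MemLp.coeFn_toLp ((Lp.memLp f).comp_mul_left hc g⁻¹),
              MemLp.coeFn_toLp ((Lp.memLp f').comp_mul_left hc g⁻¹), Lp.coeFn_add
                (((Lp.memLp f).comp_mul_left hc g⁻¹).toLp _)
                (((Lp.memLp f').comp_mul_left hc g⁻¹).toLp _),
              (quasiMeasurePreserving_mul_left_of_map_le hc g⁻¹).ae (Lp.coeFn_add f f')]
              with x h1 h2 h3 h4 h5
            rw [h1, h4, Pi.add_apply, h2, h3, h5, Pi.add_apply]
          map_smul' := fun a f => by
            ext1
            filter_upwards [MemLp.coeFn_toLp ((Lp.memLp (a • f)).comp_mul_left hc g⁻¹),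
              MemLp.coeFn_toLp ((Lp.memLp f).comp_mul_left hc g⁻¹), Lp.coeFn_smul a
                (((Lp.memLp f).comp_mul_left hc g⁻¹).toLp _),
              (quasiMeasurePreserving_mul_left_of_map_le hc g⁻¹).ae (Lp.coeFn_smul a f)]
              with x h1 h2 h3 h4
            rw [h1, RingHom.id_apply, h3, Pi.smul_apply, h2, h4, Pi.smul_apply] }
        (((c g⁻¹) ^ (1 / 2 : ℝ) : ℝ≥0) : ℝ) (norm_toLp_comp_mul_left_le hc g⁻¹)
      map_one' := by
        ext f : 1
        ext1
        filter_upwards [MemLp.coeFn_toLp ((Lp.memLp f).comp_mul_left hc (1 : G)⁻¹)] with x h1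
        refine h1.trans ?_
        simp
      map_mul' := fun g h => by
        ext f : 1
        ext1
        filter_upwards [MemLp.coeFn_toLp ((Lp.memLp f).comp_mul_left hc (g * h)⁻¹),
          MemLp.coeFn_toLp ((Lp.memLp
            (((Lp.memLp f).comp_mul_left hc h⁻¹).toLp _)).comp_mul_left hc g⁻¹),
          (quasiMeasurePreserving_mul_left_of_map_le hc g⁻¹).ae
            (MemLp.coeFn_toLp ((Lp.memLp f).comp_mul_left hc h⁻¹))] with x h1 h2 h3
        refine h1.trans (Eq.trans ?_ h2.symm)
        rw [h3, mul_inv_rev, mul_assoc] }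

theorem coeFn_translationRep (hc : ∀ g, μ.map (g * ·) ≤ (c g : ℝ≥0∞) • μ) (g : G)
    (f : Lp 𝕜 2 μ) : translationRep 𝕜 hc g f =ᵐ[μ] fun x => f (g⁻¹ * x) :=
  ((Lp.memLp f).comp_mul_left hc g⁻¹).coeFn_toLp

theorem norm_translationRep_apply_le (hc : ∀ g, μ.map (g * ·) ≤ (c g : ℝ≥0∞) • μ) (g : G)
    (f : Lp 𝕜 2 μ) :
    ‖translationRep 𝕜 hc g f‖ ≤ ((c g⁻¹) ^ (1 / 2 : ℝ) : ℝ≥0) * ‖f‖ :=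
  norm_toLp_comp_mul_left_le hc g⁻¹ f

/-- Translates of a compactly supported continuous function depend continuously on the group
element, in the mean of any order. -/
theorem tendsto_integral_norm_translate_sub_pow {E : Type*} [NormedAddCommGroup E]
    [WeaklyLocallyCompactSpace G] [IsFiniteMeasureOnCompacts μ] {f : G → E} (hf : Continuous f)
    (hs : HasCompactSupport f) {n : ℕ} (hn : n ≠ 0) (h : G) :
    Tendsto (fun g => ∫ x, ‖f (g⁻¹ * x) - f (h⁻¹ * x)‖ ^ n ∂μ) (𝓝 h) (𝓝 0) := by
  obtain ⟨C, hC, hCh⟩ := exists_compact_mem_nhds h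
  have key : ContinuousOn (fun g => ∫ x, ‖f (g⁻¹ * x) - f (h⁻¹ * x)‖ ^ n ∂μ) C := by
    -- For `g ∈ C` the integrand vanishes off the fixed compact set `C * tsupport f`.
    refine continuousOn_integral_of_compact_support (k := C * tsupport f) (hC.mul hs) ?_ ?_
    · exact Continuous.continuousOn (by unfold Function.uncurry; fun_prop)
    · intro g x hg hx
      have h0 : ∀ a ∈ C, f (a⁻¹ * x) = 0 := fun a ha => by
        refine image_eq_zero_of_notMem_tsupport fun hax => hx ?_
        exact mem_mul.2 ⟨a, ha, a⁻¹ * x, hax, by simp⟩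
      rw [h0 g hg, h0 h (mem_of_mem_nhds hCh), sub_zero, norm_zero, zero_pow hn]
  have := (key.continuousAt hCh).tendsto
  simpa [hn] using this

/-- Compactly supported continuous functions are dense by regularity, and their translates vary
continuously in mean square; local boundedness of `c` does the rest. -/
theorem isContinuousLinearRep_translationRep [LocallyCompactSpace G] [NormalSpace G] [μ.Regular]
    (hc : ∀ g, μ.map (g * ·) ≤ (c g : ℝ≥0∞) • μ)
    (hb : ∀ C : Set G, IsCompact C → ∃ M : ℝ≥0, ∀ g ∈ C, c g ≤ M) :
    IsContinuousLinearRep (translationRep 𝕜 hc) := by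
  refine isContinuousLinearRep_of_dense (fun C hC => ?_)
    (D := {F | ∃ (f : G → 𝕜) (hf : MemLp f 2 μ), Continuous f ∧ HasCompactSupport f ∧
      hf.toLp f = F}) ?_ ?_
  · obtain ⟨M, hM⟩ := hb C⁻¹ hC.inv
    refine ⟨(M ^ (1 / 2 : ℝ) : ℝ≥0), fun g hg f => (norm_translationRep_apply_le hc g f).trans ?_⟩
    gcongr
    exact hM _ (by simpa using hg)
  · refine Metric.dense_iff.2 fun F r hr => ?_
    obtain ⟨f, hfs, hfF, hf, hfm⟩ := (Lp.memLp F).exists_hasCompactSupport_eLpNorm_sub_le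
      (by simp) (ε := ENNReal.ofReal (r / 2)) (by simpa using hr)
    refine ⟨hfm.toLp f, ?_, f, hfm, hf, hfs, rfl⟩
    rw [Metric.mem_ball', ← Lp.toLp_coeFn F (Lp.memLp F), Lp.dist_def, eLpNorm_congr_ae
      ((MemLp.coeFn_toLp (Lp.memLp F)).sub (MemLp.coeFn_toLp hfm))]
    refine (ENNReal.toReal_le_of_le_ofReal (by positivity) hfF).trans_lt (by linarith)
  · rintro _ ⟨f, hfm, hf, hfs, rfl⟩
    refine continuous_iff_continuousAt.2 fun h => ?_
    rw [ContinuousAt, tendsto_iff_norm_sub_tendsto_zero]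
    have h1 : ∀ g, translationRep 𝕜 hc g (hfm.toLp f) = (hfm.comp_mul_left hc g⁻¹).toLp _ := by
      intro g
      ext1
      filter_upwards [coeFn_translationRep hc g (hfm.toLp f), (hfm.comp_mul_left hc g⁻¹).coeFn_toLp,
        (quasiMeasurePreserving_mul_left_of_map_le hc g⁻¹).ae hfm.coeFn_toLp] with x h1 h2 h3
      rw [h1, h2, h3]
    have h2 : ∀ g, ‖translationRep 𝕜 hc g (hfm.toLp f) - translationRep 𝕜 hc h (hfm.toLp f)‖ =
        (∫ x, ‖f (g⁻¹ * x) - f (h⁻¹ * x)‖ ^ 2 ∂μ) ^ (2⁻¹ : ℝ) := by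
      intro g
      rw [h1, h1, ← MemLp.toLp_sub, Lp.norm_toLp, MemLp.eLpNorm_eq_integral_rpow_norm (by simp)
        (by simp) ((hfm.comp_mul_left hc g⁻¹).sub (hfm.comp_mul_left hc h⁻¹)),
        ENNReal.toReal_ofReal (by positivity)]
      simp
    simp_rw [h2]
    have := (tendsto_integral_norm_translate_sub_pow (μ := μ) hf hfs two_ne_zero h).rpow_const
      (p := (2⁻¹ : ℝ)) (Or.inr (by norm_num))
    simpa using this

end Translation

/-! ### The weighted space `L²(u⁻¹ μ)` -/

section WeightedTranslation

theorem measurable_coe_inv {α : Type*} [MeasurableSpace α] {u : α → ℝ≥0} (hu : Measurable u) :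
    Measurable fun x => (((u x)⁻¹ : ℝ≥0) : ℝ≥0∞) :=
  hu.inv.coe_nnreal_ennreal

theorem memLp_withDensity_inv {α 𝕜 : Type*} [MeasurableSpace α] {μ : Measure α} [RCLike 𝕜]
    {u : α → ℝ≥0} (hu : Measurable u) (hu0 : ∀ x, 0 < u x)
    (hu_int : ∫⁻ x, u x ∂μ ≠ ∞) :
    MemLp (fun x => ((u x : ℝ) : 𝕜)) 2 (μ.withDensity fun x => ((u x)⁻¹ : ℝ≥0)) := by
  have hm : Measurable fun x => ((u x : ℝ) : 𝕜) :=
    RCLike.continuous_ofReal.measurable.comp hu.coe_nnreal_real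
  refine ⟨hm.aestronglyMeasurable, ?_⟩
  rw [eLpNorm_lt_top_iff_lintegral_rpow_enorm_lt_top (by simp) (by simp),
    lintegral_withDensity_eq_lintegral_mul _ (measurable_coe_inv hu) (by fun_prop)]
  refine lt_of_eq_of_lt (lintegral_congr fun x => ?_) hu_int.lt_top
  have h1 : ‖((u x : ℝ) : 𝕜)‖ₑ = u x := by
    rw [← ofReal_norm, RCLike.norm_ofReal, NNReal.abs_eq, ENNReal.ofReal_coe_nnreal]
  rw [Pi.mul_apply, h1, ENNReal.toReal_ofNat, ENNReal.rpow_ofNat, ← ENNReal.coe_pow,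
    ← ENNReal.coe_mul, pow_two, inv_mul_cancel_left₀ (hu0 x).ne']

variable {G : Type*} [Group G] [TopologicalSpace G] [IsTopologicalGroup G] [MeasurableSpace G]
  [BorelSpace G] {μ : Measure G} {u : G → ℝ≥0}

theorem lintegral_translate_withDensity_inv [μ.IsMulLeftInvariant] (hu : Measurable u)
    {F : G → ℝ≥0∞} (hF : Measurable F) (g : G) :
    ∫⁻ x, F (g⁻¹ * x) ∂(μ.withDensity fun x => ((u x)⁻¹ : ℝ≥0)) =
      ∫⁻ x, ((u (g * x))⁻¹ : ℝ≥0) * F x ∂μ := by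
  have hm : Measurable fun x => F (g⁻¹ * x) := hF.comp (Homeomorph.mulLeft g⁻¹).measurable
  rw [lintegral_withDensity_eq_lintegral_mul _ (measurable_coe_inv hu) hm,
    ← lintegral_mul_left_eq_self _ g]
  simp

/-- The translated measure has density `(u (g⁻¹ * x))⁻¹`, and `u g⁻¹ * u x ≤ u (g⁻¹ * x)`. -/
theorem map_mul_left_withDensity_inv_le [μ.IsMulLeftInvariant] (hu : Measurable u)
    (hu0 : ∀ x, 0 < u x) (hmul : ∀ x y, u x * u y ≤ u (x * y)) (g : G) :
    (μ.withDensity fun x => ((u x)⁻¹ : ℝ≥0)).map (g * ·) ≤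
      (((u g⁻¹)⁻¹ : ℝ≥0) : ℝ≥0∞) • μ.withDensity fun x => ((u x)⁻¹ : ℝ≥0) := by
  refine Measure.le_iff.2 fun s hs => ?_
  rw [← lintegral_indicator_one hs, ← lintegral_indicator_one hs, lintegral_smul_measure,
    lintegral_map (measurable_one.indicator hs) (measurable_const_mul g)]
  have h1 := lintegral_translate_withDensity_inv (μ := μ) hu
    (measurable_one.indicator hs : Measurable (s.indicator (1 : G → ℝ≥0∞))) g⁻¹
  rw [inv_inv] at h1
  rw [h1, lintegral_withDensity_eq_lintegral_mul _ (measurable_coe_inv hu)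
    (measurable_one.indicator hs), smul_eq_mul, ← lintegral_const_mul _
    ((measurable_coe_inv hu).mul (measurable_one.indicator hs))]
  refine lintegral_mono fun x => ?_
  rw [Pi.mul_apply, ← mul_assoc]
  gcongr
  rw [← ENNReal.coe_mul, ENNReal.coe_le_coe, ← mul_inv]
  exact inv_anti₀ (mul_pos (hu0 _) (hu0 _)) (hmul _ _)

theorem isLocallyFiniteMeasure_withDensity_inv [WeaklyLocallyCompactSpace G]
    [IsFiniteMeasureOnCompacts μ]
    (hC : ∀ C : Set G, IsCompact C → ∃ c > 0, ∀ x ∈ C, c ≤ u x) :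
    IsLocallyFiniteMeasure (μ.withDensity fun x => ((u x)⁻¹ : ℝ≥0)) := by
  refine ⟨fun x => ?_⟩
  obtain ⟨K, hK, hKx, hKc⟩ := exists_mem_nhds_isCompact_isClosed x
  obtain ⟨c, hc, hcu⟩ := hC K hKx
  refine ⟨K, hK, ?_⟩
  rw [withDensity_apply _ hKc.measurableSet]
  refine lt_of_le_of_lt (setLIntegral_mono (g := fun _ => ((c⁻¹ : ℝ≥0) : ℝ≥0∞)) measurable_const
    fun x hx => ?_) ?_
  · exact ENNReal.coe_le_coe.2 (inv_anti₀ hc (hcu x hx))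
  · rw [setLIntegral_const]
    exact ENNReal.mul_lt_top (by simp) hKx.measure_lt_top

/-- A Haar integrable function on a noncompact group is not bounded away from zero. -/
theorem exists_lt_of_lintegral_ne_top [LocallyCompactSpace G] [NoncompactSpace G]
    [μ.IsMulLeftInvariant] [μ.IsOpenPosMeasure] (hu_int : ∫⁻ x, u x ∂μ ≠ ∞) {c : ℝ≥0} (hc : 0 < c) :
    ∃ x, u x < c := by
  by_contra! h
  have h1 : ∫⁻ _, (c : ℝ≥0∞) ∂μ ≤ ∫⁻ x, u x ∂μ := lintegral_mono fun x => by simpa using h x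
  rw [lintegral_const, measure_univ_of_isMulLeftInvariant, ENNReal.mul_top (by simpa using hc.ne')]
    at h1
  exact hu_int (top_le_iff.1 h1)

variable {𝕜 : Type*} [RCLike 𝕜]

theorem enorm_translationRep_sq [μ.IsMulLeftInvariant] {c : G → ℝ≥0} (hu : Measurable u)
    (hc : ∀ g, (μ.withDensity fun x => ((u x)⁻¹ : ℝ≥0)).map (g * ·) ≤
      (c g : ℝ≥0∞) • μ.withDensity fun x => ((u x)⁻¹ : ℝ≥0))
    (g : G) (f : Lp 𝕜 2 (μ.withDensity fun x => ((u x)⁻¹ : ℝ≥0))) :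
    ‖translationRep 𝕜 hc g f‖ₑ ^ 2 = ∫⁻ x, ((u (g * x))⁻¹ : ℝ≥0) * ‖f x‖ₑ ^ 2 ∂μ := by
  rw [← lintegral_translate_withDensity_inv hu
    ((Lp.stronglyMeasurable f).enorm.pow_const 2) g, Lp.enorm_def,
    eLpNorm_congr_ae (coeFn_translationRep hc g f),
    eLpNorm_eq_lintegral_rpow_enorm_toReal (by simp) (by simp), ← ENNReal.rpow_natCast,
    ← ENNReal.rpow_mul]
  norm_num

/-- From `u (g * x) * u x⁻¹ ≤ u g`, `‖π g f‖²` is at least `(u g)⁻¹ * I` with `I > 0` independent of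
`g`, while `u g` can be made arbitrarily small. Finiteness of `I` is not needed. -/
theorem translationRep_unbounded [LocallyCompactSpace G] [NoncompactSpace G]
    [μ.IsMulLeftInvariant] [μ.IsOpenPosMeasure] {c : G → ℝ≥0} (hu : Measurable u)
    (hu0 : ∀ x, 0 < u x) (hmul : ∀ x y, u x * u y ≤ u (x * y)) (hu_int : ∫⁻ x, u x ∂μ ≠ ∞)
    (hc : ∀ g, (μ.withDensity fun x => ((u x)⁻¹ : ℝ≥0)).map (g * ·) ≤
      (c g : ℝ≥0∞) • μ.withDensity fun x => ((u x)⁻¹ : ℝ≥0))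
    {f : Lp 𝕜 2 (μ.withDensity fun x => ((u x)⁻¹ : ℝ≥0))} (hf : f ≠ 0) (C : ℝ) :
    ∃ g, C < ‖translationRep 𝕜 hc g f‖ := by
  have hfm := (Lp.stronglyMeasurable f).enorm.pow_const 2
  have hui : Measurable fun x => ((u x⁻¹ : ℝ≥0) : ℝ≥0∞) :=
    (hu.comp measurable_inv).coe_nnreal_ennreal
  have hum : Measurable fun x => (u x⁻¹ : ℝ≥0∞) * ‖f x‖ₑ ^ 2 := hui.mul hfm
  set I := ∫⁻ x, (u x⁻¹ : ℝ≥0∞) * ‖f x‖ₑ ^ 2 ∂μ with hI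
  have hI0 : I ≠ 0 := by
    intro h0
    refine hf ((Lp.eq_zero_iff_ae_eq_zero).2 ?_)
    rw [hI, lintegral_eq_zero_iff hum] at h0
    refine (withDensity_absolutelyContinuous μ _).ae_eq ?_
    filter_upwards [h0] with x hx
    simpa [(hu0 x⁻¹).ne'] using hx
  by_contra! hbd
  have hlow : ∀ g, ((u g)⁻¹ : ℝ≥0) * I ≤ ENNReal.ofReal C ^ 2 := by
    intro g
    calc ((u g)⁻¹ : ℝ≥0) * I
        ≤ ∫⁻ x, ((u (g * x))⁻¹ : ℝ≥0) * ‖f x‖ₑ ^ 2 ∂μ := by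
          rw [hI, ← lintegral_const_mul _ hum]
          refine lintegral_mono fun x => ?_
          rw [← mul_assoc]
          gcongr
          rw [← ENNReal.coe_mul, ENNReal.coe_le_coe, inv_mul_le_iff₀ (hu0 g),
            ← div_eq_mul_inv, le_div_iff₀ (hu0 _), mul_comm]
          simpa using hmul (g * x) x⁻¹
      _ = ‖translationRep 𝕜 hc g f‖ₑ ^ 2 := (enorm_translationRep_sq hu hc g f).symm
      _ ≤ ENNReal.ofReal C ^ 2 := by
          gcongr
          rw [← ofReal_norm]
          exact ENNReal.ofReal_le_ofReal (hbd g)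
  obtain ⟨a, ha, haI⟩ : ∃ a : ℝ≥0, 0 < a ∧ ENNReal.ofReal C ^ 2 * a < I := by
    obtain ⟨a, ha, h⟩ := ENNReal.exists_nnreal_pos_mul_lt (a := ENNReal.ofReal C ^ 2)
      (by simp) hI0
    exact ⟨a, ha, by rwa [mul_comm]⟩
  obtain ⟨g, hg⟩ := exists_lt_of_lintegral_ne_top hu_int ha
  have h1 : I ≤ ENNReal.ofReal C ^ 2 * u g := by
    calc I = u g * (((u g)⁻¹ : ℝ≥0) * I) := by
          rw [← mul_assoc, ← ENNReal.coe_mul, mul_inv_cancel₀ (hu0 g).ne', ENNReal.coe_one, one_mul]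
      _ ≤ u g * ENNReal.ofReal C ^ 2 := by gcongr; exact hlow g
      _ = _ := mul_comm _ _
  refine (h1.trans ?_).not_gt haI
  gcongr

/-- The factor `u` cancels the density `u⁻¹`, so the inner product is the integral against the
invariant measure `μ`. -/
theorem inner_weight_translationRep [μ.IsMulLeftInvariant] {c : G → ℝ≥0}
    (hu : Measurable u) (hu0 : ∀ x, 0 < u x) (hu_int : ∫⁻ x, u x ∂μ ≠ ∞)
    (hc : ∀ g, (μ.withDensity fun x => ((u x)⁻¹ : ℝ≥0)).map (g * ·) ≤
      (c g : ℝ≥0∞) • μ.withDensity fun x => ((u x)⁻¹ : ℝ≥0))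
    (g : G) (f : Lp 𝕜 2 (μ.withDensity fun x => ((u x)⁻¹ : ℝ≥0))) :
    inner 𝕜 ((memLp_withDensity_inv (𝕜 := 𝕜) hu hu0 hu_int).toLp _) (translationRep 𝕜 hc g f) =
      inner 𝕜 ((memLp_withDensity_inv (𝕜 := 𝕜) hu hu0 hu_int).toLp _) f := by
  have key : ∀ f' : Lp 𝕜 2 (μ.withDensity fun x => ((u x)⁻¹ : ℝ≥0)), ∀ F : G → 𝕜,
      f' =ᵐ[μ.withDensity fun x => ((u x)⁻¹ : ℝ≥0)] F →
      inner 𝕜 ((memLp_withDensity_inv (𝕜 := 𝕜) hu hu0 hu_int).toLp _) f' = ∫ x, F x ∂μ := by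
    intro f' F hF
    rw [L2.inner_def]
    have : ∀ᵐ x ∂(μ.withDensity fun x => ((u x)⁻¹ : ℝ≥0)),
        inner 𝕜 ((memLp_withDensity_inv (𝕜 := 𝕜) hu hu0 hu_int).toLp _ x) (f' x) =
          ((u x : ℝ) : 𝕜) * F x := by
      filter_upwards [hF, (memLp_withDensity_inv (𝕜 := 𝕜) hu hu0 hu_int).coeFn_toLp] with x h1 h2
      rw [h1, h2, RCLike.inner_apply, RCLike.conj_ofReal, mul_comm]
    rw [integral_congr_ae this, integral_withDensity_eq_integral_smul
      (f := fun x => (u x)⁻¹) hu.inv]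
    refine integral_congr_ae (.of_forall fun x => ?_)
    have h1 : ((u x : ℝ) : 𝕜) ≠ 0 := by exact_mod_cast (hu0 x).ne'
    change (u x)⁻¹ • (((u x : ℝ) : 𝕜) * F x) = F x
    rw [NNReal.smul_def, RCLike.real_smul_eq_coe_mul, NNReal.coe_inv, RCLike.ofReal_inv,
      inv_mul_cancel_left₀ h1]
  rw [key _ _ (coeFn_translationRep hc g f), key f f (ae_eq_refl _)]
  exact integral_mul_left_eq_self (fun x => f x) g⁻¹

end WeightedTranslation

/-! ### Unbounded representations on a given Hilbert space -/

/-- If a continuous linear representation on a separable Hilbert space has a nonzero invariant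
functional and no nonzero vector with a bounded orbit, then every infinite-dimensional separable
Hilbert space carries an unbounded continuous linear representation and a continuous affine
representation with all orbits unbounded. -/
theorem exists_unbounded_representations_of_invariant_functional {𝕜 : Type*} [RCLike 𝕜]
    {G : Type*} [Group G] [TopologicalSpace G]
    {V : Type*} [NormedAddCommGroup V] [InnerProductSpace 𝕜 V] [CompleteSpace V]
    [SecondCountableTopology V]
    {H : Type*} [NormedAddCommGroup H] [InnerProductSpace 𝕜 H] [CompleteSpace H]
    [TopologicalSpace.SeparableSpace H] (hH : ¬ FiniteDimensional 𝕜 H)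
    {π : G →* (V ≃L[𝕜] V)} (hπ : IsContinuousLinearRep π)
    (hub : ∀ f : V, f ≠ 0 → ∀ C : ℝ, ∃ g, C < ‖π g f‖)
    {φ : StrongDual 𝕜 V} (hφ : ∀ g f, φ (π g f) = φ f) {U : V} (hU : φ U ≠ 0) :
    (∃ π : G →* (H ≃L[𝕜] H), IsContinuousLinearRep π ∧ ¬ IsBoundedLinearRep π) ∧
    ∃ ρ : G →* (H ≃ᵃ[𝕜] H), IsContinuousAffineRep ρ ∧
      ∀ x : H, ¬ Bornology.IsBounded (affineOrbit ρ x) := by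
  constructor
  · obtain ⟨e⟩ := nonempty_prod_continuousLinearEquiv (E := V) hH
    -- The trivial summand `H` makes the space infinite-dimensional, whatever the dimension of `V`.
    refine ⟨linearRepCongr e (linearRepProd H π), hπ.prod.congr e, fun hb => ?_⟩
    obtain ⟨C, hC⟩ := isBoundedLinearRep_of_congr hb (U, 0)
    obtain ⟨g, hg⟩ := hub U (fun h => hU (by rw [h, map_zero])) C
    exact hg.not_ge ((le_max_left _ _).trans (hC g))
  · have : CompleteSpace φ.ker := φ.isClosed_ker.completeSpace_coe
    obtain ⟨e⟩ := nonempty_prod_continuousLinearEquiv (E := φ.ker) hH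
    refine ⟨affineRepCongr e (affineRepProd H (affineRepKer π φ hφ U)),
      (isContinuousAffineRep_affineRepKer hπ φ hφ U).prod.congr e, fun x hb => ?_⟩
    obtain ⟨C, hC⟩ := (isBounded_affineOrbit_of_prod
      (isBounded_affineOrbit_of_congr hb)).exists_norm_le
    set y := (e.symm x).1
    -- `y + U` lies on the hyperplane `φ = φ U`, which misses `0`.
    have hy : (y : V) + U ≠ 0 := by
      intro h0
      have h1 : φ (y + U) = φ U := by rw [map_add, show φ y = 0 from y.2, zero_add]
      rw [h0, map_zero] at h1
      exact hU h1.symm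
    obtain ⟨g, hg⟩ := hub _ hy (C + ‖U‖)
    have h1 : ‖π g (y + U) - U‖ ≤ C := hC _ ⟨g, rfl⟩
    linarith [norm_le_norm_sub_add (π g (y + U)) U]

/-- A noncompact locally compact Polish group has an unbounded continuous linear representation and
a continuous affine representation with all orbits unbounded on every infinite-dimensional
separable Hilbert space. -/
theorem exists_unbounded_representations {𝕜 : Type*} [RCLike 𝕜]
    (G : Type*) [Group G] [TopologicalSpace G] [IsTopologicalGroup G] [PolishSpace G]
    [LocallyCompactSpace G] [NoncompactSpace G]
    (H : Type*) [NormedAddCommGroup H] [InnerProductSpace 𝕜 H] [CompleteSpace H]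
    [TopologicalSpace.SeparableSpace H] (hH : ¬ FiniteDimensional 𝕜 H) :
    (∃ π : G →* (H ≃L[𝕜] H), IsContinuousLinearRep π ∧ ¬ IsBoundedLinearRep π) ∧
    ∃ ρ : G →* (H ≃ᵃ[𝕜] H), IsContinuousAffineRep ρ ∧
      ∀ x : H, ¬ Bornology.IsBounded (affineOrbit ρ x) := by
  borelize G
  obtain ⟨u, hu, hu0, hmul, hu_int, hloc⟩ :=
    exists_integrable_supermultiplicative (Measure.haar : Measure G)
  let μ : Measure G := Measure.haar.withDensity fun x => ((u x)⁻¹ : ℝ≥0)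
  have : IsLocallyFiniteMeasure μ := isLocallyFiniteMeasure_withDensity_inv hloc
  have hc : ∀ g, μ.map (g * ·) ≤ (((u g⁻¹)⁻¹ : ℝ≥0) : ℝ≥0∞) • μ :=
    map_mul_left_withDensity_inv_le hu hu0 hmul
  let V := Lp 𝕜 2 μ
  have : Fact ((2 : ℝ≥0∞) ≠ ∞) := ⟨by simp⟩
  have : SecondCountableTopology V := Lp.SecondCountableTopology
  let π : G →* (V ≃L[𝕜] V) := translationRep 𝕜 hc
  have hπ : IsContinuousLinearRep π := by
    refine isContinuousLinearRep_translationRep hc fun C hC => ?_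
    obtain ⟨a, ha, hau⟩ := hloc C⁻¹ hC.inv
    exact ⟨a⁻¹, fun g hg => inv_anti₀ ha (hau _ (by simpa using hg))⟩
  have hub : ∀ f : V, f ≠ 0 → ∀ C : ℝ, ∃ g, C < ‖π g f‖ := fun f hf C =>
    translationRep_unbounded hu hu0 hmul hu_int hc hf C
  let U : V := (memLp_withDensity_inv hu hu0 hu_int).toLp _
  have hU : U ≠ 0 := by
    intro h0
    have h1 := (Lp.eq_zero_iff_ae_eq_zero.1 h0).symm.trans (MemLp.coeFn_toLp _)
    have h2 : ∀ᵐ _ ∂μ, False := by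
      filter_upwards [h1] with x hx
      have : ((u x : ℝ) : 𝕜) ≠ 0 := by exact_mod_cast (hu0 x).ne'
      exact this hx.symm
    rw [eventually_false_iff_eq_bot, ae_eq_bot] at h2
    rw [withDensity_eq_zero_iff (measurable_coe_inv hu).aemeasurable] at h2
    have h3 : ∀ᵐ _ ∂(Measure.haar : Measure G), False := by
      filter_upwards [h2] with x hx
      simp [(hu0 x).ne'] at hx
    rw [eventually_false_iff_eq_bot, ae_eq_bot] at h3
    exact NeZero.ne _ h3
  let φ : StrongDual 𝕜 V := innerSL 𝕜 U
  have hφ : ∀ g f, φ (π g f) = φ f := inner_weight_translationRep hu hu0 hu_int hc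
  exact exists_unbounded_representations_of_invariant_functional hH hπ hub hφ
    (inner_self_ne_zero.2 hU : φ U ≠ 0)

/-! ### Property (OB) forces compactness -/

section OB

theorem PropertyOB.isBounded_orbit_of_small {G : Type u} [Group G] [TopologicalSpace G]
    (h : PropertyOB.{u, v} G) {X : Type*} [Small.{v} X] [MetricSpace X] [MulAction G X]
    [IsIsometricSMul G X] [ContinuousSMul G X] (x : X) :
    Bornology.IsBounded (MulAction.orbit G x) := by
  obtain ⟨S, ⟨e⟩⟩ := Small.equiv_small.{v} (α := X)
  let _ : MetricSpace S := MetricSpace.induced e.symm e.symm.injective inferInstance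
  let _ : MulAction G S := e.symm.mulAction G
  have he : Isometry e.symm := fun _ _ => rfl
  have hsm : ∀ (g : G) (s : S), e.symm (g • s) = g • e.symm s := fun g s => by
    simp [Equiv.smul_def]
  have : IsIsometricSMul G S := ⟨fun g s t => by
    rw [← he.edist_eq, hsm, hsm, edist_smul_left, he.edist_eq]⟩
  have : ContinuousSMul G S := ⟨by
    rw [he.isEmbedding.continuous_iff]
    simp only [Function.comp_def, hsm]
    exact continuous_fst.smul (he.continuous.comp continuous_snd)⟩
  refine (he.lipschitz.isBounded_image (h S (e x))).subset ?_
  rintro _ ⟨g, rfl⟩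
  exact ⟨g • e x, ⟨g, rfl⟩, by simp [hsm]⟩

/-- If `G` has property (OB), then a continuous map from `G` to a metric space which induces a
left invariant pseudometric has bounded range. -/
theorem PropertyOB.isBounded_range {G : Type u} [Group G] [TopologicalSpace G] [ContinuousMul G]
    [Small.{v} G] (h : PropertyOB.{u, v} G) {E : Type*} [MetricSpace E] {θ : G → E}
    (hθ : Continuous θ)
    (hinv : ∀ k g g', dist (θ (k * g)) (θ (k * g')) = dist (θ g) (θ g')) :
    Bornology.IsBounded (range θ) := by
  let p : G → range θ := fun g => ⟨θ g, g, rfl⟩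
  have hp : Function.Surjective p := by rintro ⟨_, g, rfl⟩; exact ⟨g, rfl⟩
  have hpc : Continuous p := hθ.subtype_mk _
  have hpi : ∀ k g g', dist (p (k * g)) (p (k * g')) = dist (p g) (p g') := hinv
  let s : range θ → G := Function.surjInv hp
  have hs : ∀ t, p (s t) = t := Function.surjInv_eq hp
  -- The action is `k • θ g = θ (k * g)`; invariance of the pseudometric makes it independent of the
  -- representative chosen by `s`.
  let _ : SMul G (range θ) := ⟨fun k t => p (k * s t)⟩
  have hsmul : ∀ k g, k • p g = p (k * g) := fun k g => by
    change p (k * s (p g)) = _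
    rw [← dist_eq_zero, hpi, hs, dist_self]
  let _ : MulAction G (range θ) :=
    { one_smul := fun t => by
        obtain ⟨g, rfl⟩ := hp t
        rw [hsmul, one_mul]
      mul_smul := fun k l t => by
        obtain ⟨g, rfl⟩ := hp t
        rw [hsmul, hsmul, hsmul, mul_assoc] }
  have hiso : IsIsometricSMul G (range θ) := ⟨fun k => Isometry.of_dist_eq fun t t' => by
    obtain ⟨g, rfl⟩ := hp t
    obtain ⟨g', rfl⟩ := hp t'
    rw [hsmul, hsmul, hpi]⟩
  have : ContinuousSMul G (range θ) := ⟨by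
    refine continuous_iff_continuousAt.2 fun ⟨k₀, t₀⟩ => ?_
    obtain ⟨g₀, rfl⟩ := hp t₀
    rw [ContinuousAt, tendsto_iff_dist_tendsto_zero]
    have h1 : Tendsto (fun q : G × range θ => dist q.2 (p g₀) + dist (p (q.1 * g₀)) (p (k₀ * g₀)))
        (𝓝 (k₀, p g₀)) (𝓝 0) := by
      have : Continuous fun q : G × range θ =>
          dist q.2 (p g₀) + dist (p (q.1 * g₀)) (p (k₀ * g₀)) := by fun_prop
      simpa using this.tendsto (k₀, p g₀)
    refine squeeze_zero (fun _ => dist_nonneg) (fun q => ?_) h1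
    calc dist (q.1 • q.2) (k₀ • p g₀)
        ≤ dist (q.1 • q.2) (q.1 • p g₀) + dist (q.1 • p g₀) (k₀ • p g₀) := dist_triangle _ _ _
      _ = _ := by rw [dist_smul, hsmul, hsmul]⟩
  have hb := h.isBounded_orbit_of_small (p 1)
  refine ((LipschitzWith.subtype_val (range θ)).isBounded_image hb).subset ?_
  rintro _ ⟨g, rfl⟩
  exact ⟨p g, ⟨g, by simp [hsmul]⟩, rfl⟩

/-- The functions `θ g = g·A - A` are bounded even if `A` is not, and left translation preserves
their mutual sup distances. (OB) bounds the range of `θ`, and evaluating `θ x⁻¹` at `1` recovers `A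
x - A 1`. -/
theorem PropertyOB.exists_bound {G : Type u} [Group G] [TopologicalSpace G] [ContinuousMul G]
    [Small.{v} G] (h : PropertyOB.{u, v} G) {A : G → ℝ} {B : G → G → ℝ}
    (hAB : ∀ g k x, |A (g⁻¹ * x) - A (k⁻¹ * x)| ≤ B g k)
    (hB : ∀ k, Tendsto (fun g => B g k) (𝓝 k) (𝓝 0)) : ∃ C, ∀ x, |A x| ≤ C := by
  let θ : G → lp (fun _ : G => ℝ) ∞ := fun g => ⟨fun x => A (g⁻¹ * x) - A x,
    memℓp_infty ⟨B g 1, by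
      rintro _ ⟨x, rfl⟩
      simpa using hAB g 1 x⟩⟩
  have hθ : ∀ g k x, (θ g - θ k) x = A (g⁻¹ * x) - A (k⁻¹ * x) := fun g k x => by
    change A (g⁻¹ * x) - A x - (A (k⁻¹ * x) - A x) = _
    ring
  have hle : ∀ k g g', dist (θ (k * g)) (θ (k * g')) ≤ dist (θ g) (θ g') := by
    intro k g g'
    rw [dist_eq_norm, dist_eq_norm]
    refine lp.norm_le_of_forall_le (norm_nonneg _) fun x => ?_
    have := lp.norm_apply_le_norm ENNReal.top_ne_zero (θ g - θ g') (k⁻¹ * x)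
    rw [hθ] at this ⊢
    simpa [mul_assoc] using this
  have hcont : Continuous θ := by
    refine continuous_iff_continuousAt.2 fun k => ?_
    rw [ContinuousAt, tendsto_iff_dist_tendsto_zero]
    refine squeeze_zero (fun _ => dist_nonneg) (fun g => ?_) (hB k)
    rw [dist_eq_norm]
    refine lp.norm_le_of_forall_le ((abs_nonneg _).trans (hAB g k 1)) fun x => ?_
    rw [hθ]
    exact hAB g k x
  obtain ⟨C, hC⟩ := (h.isBounded_range hcont fun k g g' => le_antisymm (hle k g g') <| by
    simpa using hle k⁻¹ (k * g) (k * g')).exists_norm_le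
  refine ⟨C + |A 1|, fun x => ?_⟩
  have h1 := (lp.norm_apply_le_norm ENNReal.top_ne_zero (θ x⁻¹) 1).trans (hC _ ⟨x⁻¹, rfl⟩)
  have h2 : ‖A (x⁻¹⁻¹ * 1) - A 1‖ ≤ C := h1
  rw [inv_inv, mul_one, Real.norm_eq_abs] at h2
  linarith [abs_sub_abs_le_abs_sub (A x) (A 1)]

variable {G : Type*} [Group G] [TopologicalSpace G] [IsTopologicalGroup G]

/-- Smoothing a subadditive function: the result differs from a multiple of the original function
by a bounded amount, and its left translates vary continuously in the uniform metric. -/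
theorem exists_smoothing_of_subadditive [LocallyCompactSpace G] [T2Space G]
    [MeasurableSpace G] [BorelSpace G]
    (μ : Measure G) [μ.IsMulLeftInvariant] [IsFiniteMeasureOnCompacts μ] [μ.IsOpenPosMeasure]
    {L : G → ℝ} (hL : Measurable L) (hadd : ∀ x y, L (x * y) ≤ L x + L y)
    (hbd : ∀ C : Set G, IsCompact C → ∃ M, ∀ x ∈ C, L x ≤ M) :
    ∃ (A : G → ℝ) (B : G → G → ℝ), (∀ g k x, |A (g⁻¹ * x) - A (k⁻¹ * x)| ≤ B g k) ∧
      (∀ k, Tendsto (fun g => B g k) (𝓝 k) (𝓝 0)) ∧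
      ∃ a > 0, ∃ b, ∀ x, a * L x ≤ A x + b := by
  obtain ⟨ψ, hψs, hψ0, hψ1⟩ := exists_continuous_nonneg_pos (1 : G)
  -- By subadditivity `m y` bounds `|L (y⁻¹ * x) - L x|` uniformly in `x`.
  let m : G → ℝ := fun y => |L y| + |L y⁻¹|
  have hmm : Measurable m := by
    have : Measurable fun y => L y⁻¹ := hL.comp measurable_inv
    exact hL.abs.add this.abs
  have hm0 : ∀ y, 0 ≤ m y := fun y => by positivity
  have hL1 : 0 ≤ L 1 := by simpa using hadd 1 1
  have habs : ∀ C : Set G, IsCompact C → ∃ M, ∀ x ∈ C, |L x| ≤ M := by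
    intro C hC
    obtain ⟨M, hM⟩ := hbd (C ∪ C⁻¹) (hC.union hC.inv)
    refine ⟨M, fun x hx => abs_le.2 ⟨?_, hM x (Or.inl hx)⟩⟩
    have h1 := hM x⁻¹ (Or.inr (by simpa using hx))
    have h2 := hadd x x⁻¹
    rw [mul_inv_cancel] at h2
    linarith
  have hmb : ∀ C : Set G, IsCompact C → ∃ M, ∀ x ∈ C, m x ≤ M := by
    intro C hC
    obtain ⟨M, hM⟩ := habs C hC
    obtain ⟨M', hM'⟩ := habs C⁻¹ hC.inv
    exact ⟨M + M', fun x hx => add_le_add (hM x hx) (hM' _ (by simpa using hx))⟩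
  have hLm : ∀ x y, |L (y⁻¹ * x) - L x| ≤ m y := by
    intro x y
    have h1 := hadd y⁻¹ x
    have h2 := hadd y (y⁻¹ * x)
    rw [mul_inv_cancel_left] at h2
    have := neg_abs_le (L y)
    have := le_abs_self (L y)
    have := le_abs_self (L y⁻¹)
    have := abs_nonneg (L y)
    have := abs_nonneg (L y⁻¹)
    rw [abs_le]
    constructor <;> simp only [m] <;> linarith
  have hfl_int : ∀ (f : G → ℝ) (l : G → ℝ), Continuous f → HasCompactSupport f → Measurable l →
      (∀ C : Set G, IsCompact C → ∃ M, ∀ x ∈ C, |l x| ≤ M) →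
      Integrable (fun y => f y * l y) μ := by
    intro f l hf hfs hl hlb
    obtain ⟨M, hM⟩ := hlb _ hfs
    refine ((hf.integrable_of_hasCompactSupport hfs).norm.mul_const M).mono'
      (hf.measurable.mul hl).aestronglyMeasurable (.of_forall fun y => ?_)
    by_cases hy : y ∈ tsupport f
    · rw [norm_mul]
      gcongr
      exact hM y hy
    · simp [image_eq_zero_of_notMem_tsupport hy]
  have hψg : ∀ g : G, Continuous (fun y => ψ (g⁻¹ * y)) ∧
      HasCompactSupport fun y => ψ (g⁻¹ * y) := fun g =>
    ⟨by fun_prop, hψs.comp_homeomorph (Homeomorph.mulLeft g⁻¹)⟩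
  have hLx : ∀ x, Measurable fun y => L (y⁻¹ * x) := fun x =>
    hL.comp (by fun_prop : Measurable fun y : G => y⁻¹ * x)
  have hLxb : ∀ x, ∀ C : Set G, IsCompact C → ∃ M, ∀ y ∈ C, |L (y⁻¹ * x)| ≤ M := by
    intro x C hC
    obtain ⟨M, hM⟩ := hmb C hC
    refine ⟨M + |L x|, fun y hy => ?_⟩
    linarith [abs_sub_abs_le_abs_sub (L (y⁻¹ * x)) (L x), hLm x y, hM y hy]
  -- The convolution of `ψ` with `L`: translating `A` amounts to translating `ψ`.
  let A : G → ℝ := fun x => ∫ y, ψ y * L (y⁻¹ * x) ∂μ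
  have hA : ∀ g x, A (g⁻¹ * x) = ∫ y, ψ (g⁻¹ * y) * L (y⁻¹ * x) ∂μ := by
    intro g x
    rw [← integral_mul_left_eq_self _ g]
    simp [A, mul_assoc]
  have hψint : ∀ g : G, ∫ y, ψ (g⁻¹ * y) ∂μ = ∫ y, ψ y ∂μ := fun g =>
    integral_mul_left_eq_self (fun y => ψ y) g⁻¹
  let B : G → G → ℝ := fun g k => ∫ y, ‖ψ (g⁻¹ * y) - ψ (k⁻¹ * y)‖ * m y ∂μ
  refine ⟨A, B, fun g k x => ?_, fun k => ?_, ∫ y, ψ y ∂μ, ?_, ∫ y, ψ y * m y ∂μ, fun x => ?_⟩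
  -- Translates of `ψ` have equal integrals, so `L x` may be subtracted; this makes the estimate
  -- uniform in `x`.
  · have h1 : A (g⁻¹ * x) - A (k⁻¹ * x) =
        ∫ y, (ψ (g⁻¹ * y) - ψ (k⁻¹ * y)) * (L (y⁻¹ * x) - L x) ∂μ := by
      have e1 := hfl_int _ _ (hψg g).1 (hψg g).2 (hLx x) (hLxb x)
      have e2 := hfl_int _ _ (hψg k).1 (hψg k).2 (hLx x) (hLxb x)
      have e3 := ((hψg g).1.integrable_of_hasCompactSupport (μ := μ) (hψg g).2).mul_const (L x)
      have e4 := ((hψg k).1.integrable_of_hasCompactSupport (μ := μ) (hψg k).2).mul_const (L x)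
      have : ∀ y, (ψ (g⁻¹ * y) - ψ (k⁻¹ * y)) * (L (y⁻¹ * x) - L x) =
          (ψ (g⁻¹ * y) * L (y⁻¹ * x) - ψ (k⁻¹ * y) * L (y⁻¹ * x)) -
          (ψ (g⁻¹ * y) * L x - ψ (k⁻¹ * y) * L x) := fun y => by ring
      simp_rw [this]
      rw [integral_sub (by exact e1.sub e2) (by exact e3.sub e4), integral_sub e1 e2,
        integral_sub e3 e4, integral_mul_const, integral_mul_const, hψint, hψint, sub_self,
        sub_zero, hA, hA]
    rw [h1, ← Real.norm_eq_abs]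
    refine norm_integral_le_of_norm_le (hfl_int _ _ ((hψg g).1.sub (hψg k).1).norm
      ((hψg g).2.sub (hψg k).2).norm hmm fun C hC => ?_) (.of_forall fun y => ?_)
    · obtain ⟨M, hM⟩ := hmb C hC
      exact ⟨M, fun y hy => by rw [abs_of_nonneg (hm0 y)]; exact hM y hy⟩
    · rw [norm_mul]
      gcongr
      exact hLm x y
  · obtain ⟨C, hC, hCk⟩ := exists_compact_mem_nhds k
    obtain ⟨M, hM⟩ := hmb _ (hC.mul hψs)
    have h1 := (tendsto_integral_norm_translate_sub_pow (μ := μ) ψ.continuous hψs one_ne_zero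
      k).mul_const M
    rw [zero_mul] at h1
    refine squeeze_zero' (.of_forall fun g => integral_nonneg fun y => by positivity) ?_ h1
    filter_upwards [hCk] with g hg
    rw [← integral_mul_const]
    refine integral_mono_of_nonneg (.of_forall fun y => by positivity) ?_
      (.of_forall fun y => ?_)
    · simpa using (((hψg g).1.sub (hψg k).1).integrable_of_hasCompactSupport (μ := μ)
        ((hψg g).2.sub (hψg k).2)).norm.mul_const M
    · by_cases hy : y ∈ C * tsupport ψ
      · simp only [pow_one]
        gcongr
        exact hM y hy
      · have h0 : ∀ a ∈ C, ψ (a⁻¹ * y) = 0 := fun a ha => by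
          refine image_eq_zero_of_notMem_tsupport fun hay => hy ?_
          exact mem_mul.2 ⟨a, ha, a⁻¹ * y, hay, by simp⟩
        simp [h0 g hg, h0 k (mem_of_mem_nhds hCk)]
  · exact ψ.continuous.integral_pos_of_hasCompactSupport_nonneg_nonzero hψs hψ0 hψ1
  -- Integrate `L x ≤ L (y⁻¹ * x) + m y` against `ψ`.
  · have e1 := hfl_int _ _ ψ.continuous hψs (hLx x) (hLxb x)
    have e2 := hfl_int _ _ ψ.continuous hψs hmm fun C hC => by
      obtain ⟨M, hM⟩ := hmb C hC
      exact ⟨M, fun y hy => by rw [abs_of_nonneg (hm0 y)]; exact hM y hy⟩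
    rw [← integral_mul_const, ← integral_add e1 e2]
    refine integral_mono ((ψ.continuous.integrable_of_hasCompactSupport hψs).mul_const _)
      (e1.add e2) fun y => ?_
    have := abs_le.1 (hLm x y)
    have h0 : 0 ≤ ψ y := hψ0 y
    simp only [← mul_add]
    gcongr
    linarith

theorem compactSpace_of_propertyOB (G : Type u) [Group G] [TopologicalSpace G]
    [IsTopologicalGroup G] [PolishSpace G] [LocallyCompactSpace G] (h : PropertyOB.{u, v} G) :
    CompactSpace G := by
  by_contra hcomp
  rw [not_compactSpace_iff] at hcomp
  borelize G
  obtain ⟨u, hu, hu0, hmul, hu_int, hloc⟩ :=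
    exists_integrable_supermultiplicative (Measure.haar : Measure G)
  have : Small.{v} G := by
    let _ := TopologicalSpace.metrizableSpaceMetric G
    exact small_of_separableSpace G
  obtain ⟨A, B, hAB, hB, a, ha, b, hA⟩ := exists_smoothing_of_subadditive
    (Measure.haar : Measure G) (L := fun x => -Real.log (u x))
    (Real.measurable_log.comp hu.coe_nnreal_real).neg
    (fun x y => by
      have h0 : ∀ x, (0 : ℝ) < u x := fun x => by exact_mod_cast hu0 x
      have h1 : Real.log (u x * u y) ≤ Real.log (u (x * y)) :=
        Real.log_le_log (mul_pos (h0 x) (h0 y)) (by exact_mod_cast hmul x y)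
      rw [Real.log_mul (h0 x).ne' (h0 y).ne'] at h1
      linarith)
    (fun C hC => by
      obtain ⟨c, hc, hcu⟩ := hloc C hC
      refine ⟨-Real.log c, fun x hx => neg_le_neg ?_⟩
      exact Real.log_le_log (by exact_mod_cast hc) (by exact_mod_cast hcu x hx))
  obtain ⟨C, hC⟩ := h.exists_bound hAB hB
  -- This threshold makes `a * L x` exceed `C + b`, contradicting `a * L x ≤ A x + b` and `|A x| ≤
  -- C`.
  obtain ⟨x, hx⟩ := exists_lt_of_lintegral_ne_top hu_int
    (c := ⟨Real.exp (-((C + b) / a)), (Real.exp_pos _).le⟩) (Real.exp_pos _)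
  have h1 : Real.log (u x) < -((C + b) / a) := by
    rw [Real.log_lt_iff_lt_exp (by exact_mod_cast hu0 x)]
    exact_mod_cast hx
  have h2 : C + b < a * -Real.log (u x) := by
    rw [← div_lt_iff₀' ha]
    linarith
  linarith [hA x, le_abs_self (A x), hC x]

end OB

/-! ### Assembling the equivalences -/

/-- Hilbert spaces are reflexive; a `Shrink` copy of `H` moves the action to the universe of (ACR).
-/
theorem PropertyACR.exists_fixedPoint {𝕜 : Type u₁} [RCLike 𝕜] {G : Type u₂} [Group G]
    [TopologicalSpace G] (h : PropertyACR.{u₂, v₂, u₁} 𝕜 G) {H : Type*} [NormedAddCommGroup H]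
    [InnerProductSpace 𝕜 H] [CompleteSpace H] [TopologicalSpace.SeparableSpace H]
    {ρ : G →* (H ≃ᵃ[𝕜] H)} (hρ : IsContinuousAffineRep ρ) : ∃ x, ∀ g, ρ g x = x := by
  have : Small.{v₂} H := small_of_separableSpace H
  let e₀ : Shrink.{v₂} H ≃ₗ[𝕜] H := Shrink.linearEquiv 𝕜 H
  have hn : ∀ x, ‖e₀ x‖ = ‖x‖ := fun x => rfl
  let e : H ≃L[𝕜] Shrink.{v₂} H :=
    (⟨e₀, hn⟩ : Shrink.{v₂} H ≃ₗᵢ[𝕜] H).symm.toContinuousLinearEquiv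
  have : CompleteSpace (Shrink.{v₂} H) :=
    (completeSpace_congr (e := e.toEquiv) e.isUniformEmbedding).1 inferInstance
  have : TopologicalSpace.SeparableSpace (Shrink.{v₂} H) :=
    e.surjective.denseRange.separableSpace e.continuous
  obtain ⟨x, hx⟩ := h (Shrink.{v₂} H)
    ((isReflexiveSpace_of_innerProductSpace 𝕜 H).of_continuousLinearEquiv e) _ (hρ.congr e)
  refine ⟨e.symm x, fun g => e.injective ?_⟩
  simpa using hx g

theorem isBounded_affineOrbit_of_fixedPoint {𝕜 X G : Type*} [RCLike 𝕜] [Group G]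
    [NormedAddCommGroup X] [NormedSpace 𝕜 X] {ρ : G →* (X ≃ᵃ[𝕜] X)} {x : X}
    (hx : ∀ g, ρ g x = x) : Bornology.IsBounded (affineOrbit ρ x) := by
  refine Bornology.isBounded_singleton (x := x) |>.subset ?_
  rintro _ ⟨g, rfl⟩
  exact hx g

theorem propertyOB_of_compactSpace (G : Type u) [Group G] [TopologicalSpace G] [CompactSpace G] :
    PropertyOB.{u, v} G := fun X _ _ _ _ x =>
  (isCompact_range (f := fun g : G => g • x) (by fun_prop)).isBounded

theorem mainTheorem2 {𝕜 : Type u₁} [RCLike 𝕜]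
    (G : Type u₂) [Group G] [TopologicalSpace G] [IsTopologicalGroup G] [PolishSpace G]
    [LocallyCompactSpace G]
    (H : Type u₃) [NormedAddCommGroup H] [InnerProductSpace 𝕜 H] [CompleteSpace H]
    [TopologicalSpace.SeparableSpace H] (hH : ¬ FiniteDimensional 𝕜 H) :
    List.TFAE [
      CompactSpace G,
      PropertyOB.{u₂, v₁} G,
      PropertyACR.{u₂, v₂, u₁} 𝕜 G,
      ∀ π : G →* (H ≃L[𝕜] H), IsContinuousLinearRep π → IsBoundedLinearRep π,
      ∀ ρ : G →* (H ≃ᵃ[𝕜] H), IsContinuousAffineRep ρ → ∃ x : H, ∀ g : G, ρ g x = x,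
      ∀ ρ : G →* (H ≃ᵃ[𝕜] H), IsContinuousAffineRep ρ →
        ∃ x : H, Bornology.IsBounded (affineOrbit ρ x)] ∧
    (¬ CompactSpace G →
      ∃ ρ : G →* (H ≃ᵃ[𝕜] H), IsContinuousAffineRep ρ ∧
        ∀ x : H, ¬ Bornology.IsBounded (affineOrbit ρ x)) := by
  have unbounded : ¬ CompactSpace G →
      (∃ π : G →* (H ≃L[𝕜] H), IsContinuousLinearRep π ∧ ¬ IsBoundedLinearRep π) ∧
      ∃ ρ : G →* (H ≃ᵃ[𝕜] H), IsContinuousAffineRep ρ ∧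
        ∀ x : H, ¬ Bornology.IsBounded (affineOrbit ρ x) := fun h =>
    have := not_compactSpace_iff.1 h
    exists_unbounded_representations G H hH
  refine ⟨?_, fun h => (unbounded h).2⟩
  tfae_have 1 → 2 := fun _ => propertyOB_of_compactSpace G
  tfae_have 2 → 1 := compactSpace_of_propertyOB G
  tfae_have 1 → 3 := fun _ _ _ _ _ _ _ _ hρ => exists_fixedPoint_of_compactSpace hρ
  tfae_have 3 → 5 := fun h _ hρ => h.exists_fixedPoint hρ
  tfae_have 5 → 6 := fun h ρ hρ =>
    let ⟨x, hx⟩ := h ρ hρ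
    ⟨x, isBounded_affineOrbit_of_fixedPoint hx⟩
  tfae_have 6 → 1 := fun h => by
    by_contra hG
    obtain ⟨ρ, hρ, hub⟩ := (unbounded hG).2
    obtain ⟨x, hx⟩ := h ρ hρ
    exact hub x hx
  tfae_have 1 → 4 := fun _ _ hπ => isBoundedLinearRep_of_compactSpace hπ
  tfae_have 4 → 1 := fun h => by
    by_contra hG
    obtain ⟨π, hπ, hub⟩ := (unbounded hG).1
    exact hub (h π hπ)
  tfae_finish
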